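/- **Theorem (Agreement of Alea-BFT).** Consider $N=3f+1$ processes, of which a fixed set of at most $f$ is Byzantine, running Alea-BFT (described below) in an asynchronous system. Almost surely the following holds: for every message $m$, if some correct process delivers $m$, then every correct process eventually delivers $m$. *System.* An execution is an infinite sequence of events whose order, like all behaviour of the Byzantine processes, is controlled by the adversary. A message received by a correct process from a correct process was sent by it before; a message sent by a correct process to a correct process is eventually received; the agreement loop of a correct process is scheduled infinitely often. An execution is a random variable on an arbitrary probability space (almost surely satisfying all the requirements stated here other than ABA termination, which is a statement about probabilities). *Building blocks.* The protocol uses instances $\mathrm{VCBC}(j,p)$ ($j$ a process, the sender; $p\in\mathbb N$) of verifiable consistent broadcast and instances $\mathrm{ABA}(r)$ ($r\in\mathbb N$) of asynchronous binary agreement, which have the following properties. VCBC: (validity) if a correct sender broadcasts $v$, all correct processes eventually output $v$; (consistency) two correct processes never output different values in the same instance; (integrity) a correct process outputs at most once per instance, and if the sender is correct, a value it has broadcast before; (verifiability) a correct process that has output $v$ obtains a message $M$ such that every correct process to whose instance $M$ is later delivered outputs $v$. ABA: (agreement) correct processes do not decide differently; (validity) if all the proposals that correct processes have made so far are equal to $b$,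 a correct process can only decide $b$, i.e. a decided bit has already been proposed by a correct process; (termination) if all correct processes propose, then for every correct process the probability that it is undecided after $k$ of its rounds tends to $0$ as $k\to\infty$. (Precisely: for every instance $r$ and correct process $i$, the probability of the event that all correct processes propose in $\mathrm{ABA}(r)$ and $i$ does not decide in it within its first $k$ rounds tends to $0$.) *Protocol.* Fix a batch size $B$ and a queue mapping function $F:\mathbb N\to\{0,\dots,N-1\}$. A proposal is a finite set of messages. A priority queue has a slot for each $s\in\mathbb N$, which is empty, or contains a proposal, or is used up (its proposal was removed); inserting into a non-empty or used-up slot has no effect. Its head is the lowest slot that is not used up, and $\mathrm{Peek}$ returns the content of the head slot, or $\bot$ if it is empty. Every process $i$ has a set $S_i$ of delivered messages, a record of the proposals it has delivered, a buffer, a counter $p_i$, a queue $Q_j$ for each process $j$ (initially everything is empty or $0$), and behaves as follows; each rule is atomic up to its next waiting point. 1. When a message $m\notin S_i$ arrives from a client: add $m$ to the buffer; if the buffer then has $B$ elements, broadcast it as a proposal in $\mathrm{VCBC}(i,p_i)$, empty it, and increase $p_i$ by $1$. 2. When $\mathrm{VCBC}(j,p)$ outputs $v$: insert $v$ into slot $p$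 of $Q_j$; if $i$ has already delivered the proposal $v$, remove $v$ from $Q_j$. 3. Agreement loop, for $r=0,1,2,\dots$, with $Q=Q_{F(r)}$: propose in $\mathrm{ABA}(r)$ the bit $1$ if $Q.\mathrm{Peek}\ne\bot$ and $0$ otherwise; wait for the decision $b$ of $\mathrm{ABA}(r)$. If $b=1$: if $Q.\mathrm{Peek}=\bot$, send $\langle\mathrm{FILL\text{-}GAP},F(r),\text{head of }Q\rangle$ to all processes; wait until $v=Q.\mathrm{Peek}\neq\bot$; then deliver the proposal $v$: remove all copies of $v$ from all queues, and deliver every message $m\in v\setminus S_i$ and add it to $S_i$. 4. On receipt of $\langle\mathrm{FILL\text{-}GAP},q,s\rangle$ from $j$: if the head $h$ of $Q_q$ is at least $s$, send to $j$ a FILLER message with the verifiable messages of those instances $\mathrm{VCBC}(q,s')$, $s\le s'\le h$, that have already produced an output at $i$. 5. On receipt of a FILLER message: deliver each entry to the corresponding VCBC instance. -/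

import Mathlib

open MeasureTheory Filter Topology

namespace Alea

/-! ### Processes, priority queues, messages -/

/-- The `N = 3f + 1` processes. -/
abbrev Proc (f : ℕ) := Fin (3 * f + 1)

/-- The tag `(j, p)` of the VCBC instance in which process `j` broadcasts its proposal with
priority `p`. -/
abbrev VcbcId (f : ℕ) := Proc f × ℕ

/-- Content of a slot of a priority queue: nothing inserted yet, an element, or an element was
inserted and has been removed (the slot is then used up for ever). -/
inductive Slot (α : Type*) where
  | empty : Slot α
  | full (v : α) : Slot α
  | removed : Slot α

/-- A priority queue: one slot for every priority value. -/
structure PQueue (α : Type*) where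
  slot : ℕ → Slot α

namespace PQueue

variable {α : Type*}

/-- A new, empty priority queue. -/
def new : PQueue α := ⟨fun _ => Slot.empty⟩

/-- The head: the lowest slot whose value has not been removed yet. -/
noncomputable def head (Q : PQueue α) : ℕ := sInf {s | Q.slot s ≠ Slot.removed}

/-- The element in the head slot; `none` stands for `⊥`. -/
noncomputable def peek (Q : PQueue α) : Option α :=
  match Q.slot Q.head with
  | Slot.full v => some v
  | _ => none

/-- Insert `v` with priority `s`; ignored if the slot has been used already. -/
def enqueue (Q : PQueue α) (s : ℕ) (v : α) : PQueue α :=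
  ⟨fun s' => if s' = s then
      (match Q.slot s with
        | Slot.empty => Slot.full v
        | x => x)
    else Q.slot s'⟩

/-- Remove all instances of `v`. -/
def dequeue [DecidableEq α] (Q : PQueue α) (v : α) : PQueue α :=
  ⟨fun s => match Q.slot s with
    | Slot.full w => if w = v then Slot.removed else Slot.full w
    | x => x⟩

end PQueue

/-- The point-to-point messages of the protocol (outside of its sub-protocols). `V` is the type of
the verifiable messages of VCBC; an entry of a `FILLER` message is such a verifiable message,
together with the tag of the VCBC instance that it belongs to. -/
inductive NetMsg (f : ℕ) (V : Type*) where
  | fillGap (q : Proc f) (s : ℕ) : NetMsg f V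
  | filler (entries : List (VcbcId f × V)) : NetMsg f V

/-! ### The local algorithm -/

/-- Where the agreement loop stands: at the top of an iteration, waiting for the decision of the
current ABA, or waiting for a value in the head slot. -/
inductive Pc where
  | top : Pc
  | waitDecision : Pc
  | waitHead : Pc

/-- Local state of a process. `Msg` is the type of client messages, a proposal (or batch) is a
finite set of messages. -/
structure LocalState (f : ℕ) (Msg V : Type*) where
  /-- the set of delivered messages -/
  S : Finset Msg
  /-- the proposals that have been delivered -/
  ordered : Finset (Finset Msg)
  /-- the `N` priority queues -/
  queues : Proc f → PQueue (Finset Msg)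
  /-- the buffer of pending client messages -/
  buf : Finset Msg
  /-- the priority of the next own proposal -/
  priority : ℕ
  /-- the current agreement round -/
  round : ℕ
  /-- control location of the agreement loop -/
  pc : Pc
  /-- for the VCBC instances that have terminated locally: the output, and the verifiable message
  that proves it to other processes -/
  vcbc : VcbcId f → Option (Finset Msg × V)
  /-- the decisions of the ABA instances that have terminated locally -/
  aba : ℕ → Option Bool

/-- The initial local state. -/
def LocalState.init (f : ℕ) (Msg V : Type*) : LocalState f Msg V where
  S := ∅
  ordered := ∅
  queues := fun _ => PQueue.new
  buf := ∅
  priority := 0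
  round := 0
  pc := Pc.top
  vcbc := fun _ => none
  aba := fun _ => none

/-- What can happen in the system. Everything but `idle` happens at one process `i`.
* `client i m`: the message `m` of some client arrives at `i`;
* `vcbcOut i id m M`: the VCBC instance `id` outputs the proposal `m` at `i`, and `M` is the
  verifiable message that `i` can produce from now on;
* `abaRound i r`: `i` completes a further internal round of ABA `r`;
* `abaOut i r b`: ABA `r` decides `b` at `i`;
* `recv i j x`: the network hands to `i` the message `x` from `j`;
* `loop i`: the agreement loop of `i` is scheduled. -/
inductive Event (f : ℕ) (Msg V : Type*) where
  | idle : Event f Msg V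
  | client (i : Proc f) (m : Msg) : Event f Msg V
  | vcbcOut (i : Proc f) (id : VcbcId f) (m : Finset Msg) (M : V) : Event f Msg V
  | abaRound (i : Proc f) (r : ℕ) : Event f Msg V
  | abaOut (i : Proc f) (r : ℕ) (b : Bool) : Event f Msg V
  | recv (i j : Proc f) (x : NetMsg f V) : Event f Msg V
  | loop (i : Proc f) : Event f Msg V

/-- What a process does in reaction to an event, besides changing its local state.
* `send j x`: send `x` to process `j`;
* `vcbcIn id m`: input `m` to the VCBC instance `id`;
* `vcbcMsg id M`: deliver the verifiable message `M` to the local VCBC instance `id`;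
* `abaIn r b`: input `b` to ABA `r`;
* `output m`: deliver the message `m` to the application. -/
inductive Action (f : ℕ) (Msg V : Type*) where
  | send (j : Proc f) (x : NetMsg f V) : Action f Msg V
  | vcbcIn (id : VcbcId f) (m : Finset Msg) : Action f Msg V
  | vcbcMsg (id : VcbcId f) (M : V) : Action f Msg V
  | abaIn (r : ℕ) (b : Bool) : Action f Msg V
  | output (m : Msg) : Action f Msg V

section Algorithm

variable {f : ℕ} {Msg V : Type*} [DecidableEq Msg]

/-- Broadcast component: a client message `m` arrives at `i`; `B` is the batch size. -/
def onClient (B : ℕ) (i : Proc f) (st : LocalState f Msg V) (m : Msg) :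
    LocalState f Msg V × Set (Action f Msg V) :=
  if m ∈ st.S then (st, ∅)
  else
    let buf := st.buf ∪ {m}
    if buf.card = B then
      ({ st with buf := ∅, priority := st.priority + 1 },
        {Action.vcbcIn (i, st.priority) buf})
    else ({ st with buf := buf }, ∅)

/-- Broadcast component: VCBC `(j, p)` outputs the proposal `m`, with verifiable message `M`. A
proposal that has already been delivered is removed from the queue at once. -/
def onVcbcOut (st : LocalState f Msg V) (id : VcbcId f) (m : Finset Msg) (M : V) :
    LocalState f Msg V :=
  let Q := (st.queues id.1).enqueue id.2 m
  let Q' := if m ∈ st.ordered then Q.dequeue m else Q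
  { st with
    queues := Function.update st.queues id.1 Q'
    vcbc := Function.update st.vcbc id (some (m, M)) }

/-- The verifiable messages for those of the VCBC instances `(q, s')`, `s ≤ s' ≤ h`, that have
terminated locally. -/
def fillerEntries (st : LocalState f Msg V) (q : Proc f) (s h : ℕ) : List (VcbcId f × V) :=
  (List.range' s (h + 1 - s)).filterMap
    fun s' => (st.vcbc (q, s')).map fun x => ((q, s'), x.2)

/-- Agreement component: the recovery rules for a message `x` from process `j`. -/
noncomputable def onRecv (st : LocalState f Msg V) (j : Proc f) :
    NetMsg f V → Set (Action f Msg V)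
  | NetMsg.fillGap q s =>
      {a | s ≤ (st.queues q).head ∧
        a = Action.send j (NetMsg.filler (fillerEntries st q s (st.queues q).head))}
  | NetMsg.filler entries => {a | ∃ e ∈ entries, a = Action.vcbcMsg e.1 e.2}

/-- The procedure AC-DELIVER for the proposal `v`, and the transition to the next round. -/
def acDeliver (st : LocalState f Msg V) (v : Finset Msg) :
    LocalState f Msg V × Set (Action f Msg V) :=
  ({ st with
      queues := fun q => (st.queues q).dequeue v
      S := st.S ∪ v
      ordered := st.ordered ∪ {v}
      round := st.round + 1
      pc := Pc.top },
    {a | ∃ m ∈ v, m ∉ st.S ∧ a = Action.output m})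

/-- Agreement component: the agreement loop runs up to its next waiting point. `F` is the queue
mapping function. -/
noncomputable def onLoop (F : ℕ → Proc f) (st : LocalState f Msg V) :
    LocalState f Msg V × Set (Action f Msg V) :=
  let Q := st.queues (F st.round)
  match st.pc with
  | Pc.top =>
      ({ st with pc := Pc.waitDecision }, {Action.abaIn st.round Q.peek.isSome})
  | Pc.waitDecision =>
      match st.aba st.round with
      | none => (st, ∅)
      | some false => ({ st with round := st.round + 1, pc := Pc.top }, ∅)
      | some true =>
          ({ st with pc := Pc.waitHead },
            {a | Q.peek = none ∧
              ∃ j : Proc f, a = Action.send j (NetMsg.fillGap (F st.round) Q.head)})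
  | Pc.waitHead =>
      match Q.peek with
      | none => (st, ∅)
      | some v => acDeliver st v

/-- Reaction of process `i`, in local state `st`, to an event. Events of other processes do not
affect `i`. -/
noncomputable def react (F : ℕ → Proc f) (B : ℕ) (i : Proc f) (st : LocalState f Msg V) :
    Event f Msg V → LocalState f Msg V × Set (Action f Msg V)
  | Event.idle => (st, ∅)
  | Event.client i' m => if i' = i then onClient B i st m else (st, ∅)
  | Event.vcbcOut i' id m M => if i' = i then (onVcbcOut st id m M, ∅) else (st, ∅)
  | Event.abaRound _ _ => (st, ∅)
  | Event.abaOut i' r b =>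
      if i' = i then ({ st with aba := Function.update st.aba r (some b) }, ∅) else (st, ∅)
  | Event.recv i' j x => if i' = i then (st, onRecv st j x) else (st, ∅)
  | Event.loop i' => if i' = i then onLoop F st else (st, ∅)

/-- Local state of process `i` before the event number `t` of the event sequence `e`, if `i` follows
the protocol. -/
noncomputable def state (F : ℕ → Proc f) (B : ℕ) (e : ℕ → Event f Msg V) (i : Proc f) :
    ℕ → LocalState f Msg V
  | 0 => LocalState.init f Msg V
  | t + 1 => (react F B i (state F B e i t) (e t)).1

/-- `i`, following the protocol, performs the action `a` at time `t`. -/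
def Does (F : ℕ → Proc f) (B : ℕ) (e : ℕ → Event f Msg V) (i : Proc f) (t : ℕ)
    (a : Action f Msg V) : Prop :=
  a ∈ (react F B i (state F B e i t) (e t)).2

/-- `i` delivers the message `m` at some time. -/
def Delivers (F : ℕ → Proc f) (B : ℕ) (e : ℕ → Event f Msg V) (i : Proc f) (m : Msg) : Prop :=
  ∃ t, Does F B e i t (Action.output m)

/-! ### Executions

In all that follows, `C` is the set of correct processes. The faulty processes are under the control
of the adversary, as is the order of events: the events and messages of faulty processes are not
restricted at all, and what `state` and `Does` say about a faulty process is never used. -/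

/-- The channels: a message received from a correct process was sent by it, and a message from one
correct process to another is eventually received. -/
structure Channels (F : ℕ → Proc f) (B : ℕ) (C : Set (Proc f)) (e : ℕ → Event f Msg V) : Prop where
  authentic : ∀ i ∈ C, ∀ j ∈ C, ∀ x t, e t = Event.recv i j x →
    ∃ t' < t, Does F B e j t' (Action.send i x)
  eventual_delivery : ∀ i ∈ C, ∀ j ∈ C, ∀ x t, Does F B e j t (Action.send i x) →
    ∃ t' > t, e t' = Event.recv i j x

/-- Specification of verifiable consistent broadcast, for all instances. -/
structure VCBC (F : ℕ → Proc f) (B : ℕ) (C : Set (Proc f)) (e : ℕ → Event f Msg V) : Prop where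
  /-- If a correct sender broadcasts `m`, then all correct processes eventually deliver `m`. -/
  validity : ∀ j ∈ C, ∀ p m t, Does F B e j t (Action.vcbcIn (j, p) m) →
    ∀ i ∈ C, ∃ t' M, e t' = Event.vcbcOut i (j, p) m M
  /-- No two correct processes deliver different values. -/
  consistency : ∀ i ∈ C, ∀ i' ∈ C, ∀ id m m' M M' t t',
    e t = Event.vcbcOut i id m M → e t' = Event.vcbcOut i' id m' M' → m = m'
  /-- A correct process delivers at most once. -/
  integrity_once : ∀ i ∈ C, ∀ id m m' M M' t t',
    e t = Event.vcbcOut i id m M → e t' = Event.vcbcOut i id m' M' → t = t'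
  /-- If the sender is correct, then a delivered value was broadcast by it. -/
  integrity_sender : ∀ i ∈ C, ∀ j ∈ C, ∀ p m M t, e t = Event.vcbcOut i (j, p) m M →
    ∃ t' < t, Does F B e j t' (Action.vcbcIn (j, p) m)
  /-- The verifiable message `M` of a correct process that has delivered `m` makes every correct
  process that receives it deliver `m` too. -/
  verifiability : ∀ i ∈ C, ∀ i' ∈ C, ∀ id m M t t', e t = Event.vcbcOut i id m M → t < t' →
    Does F B e i' t' (Action.vcbcMsg id M) → ∃ t'' M', e t'' = Event.vcbcOut i' id m M'

/-- Specification of asynchronous binary agreement, for all instances, without termination. -/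
structure ABASafety (F : ℕ → Proc f) (B : ℕ) (C : Set (Proc f)) (e : ℕ → Event f Msg V) :
    Prop where
  /-- No two correct processes decide differently. -/
  agreement : ∀ i ∈ C, ∀ i' ∈ C, ∀ r b b' t t',
    e t = Event.abaOut i r b → e t' = Event.abaOut i' r b' → b = b'
  /-- A correct process only decides for a value that some correct process has already proposed:
  if every proposal of a correct process so far is `b`, then only `b` can be decided. -/
  validity : ∀ i ∈ C, ∀ r b t, e t = Event.abaOut i r b →
    ∃ i' ∈ C, ∃ t' < t, Does F B e i' t' (Action.abaIn r b)

/-- The event sequence `e` is an execution of the protocol in an asynchronous system with correct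
processes `C`: the channels, VCBC and ABA behave as specified, and the agreement loop of a correct
process is scheduled again and again. -/
structure IsExecution (F : ℕ → Proc f) (B : ℕ) (C : Set (Proc f)) (e : ℕ → Event f Msg V) :
    Prop where
  channels : Channels F B C e
  vcbc : VCBC F B C e
  aba : ABASafety F B C e
  fair : ∀ i ∈ C, ∀ t, ∃ t' ≥ t, e t' = Event.loop i

/-- The number of rounds of ABA `r` that `i` has completed before time `t`. -/
noncomputable def abaRounds (e : ℕ → Event f Msg V) (i : Proc f) (r t : ℕ) : ℕ :=
  {t' | t' < t ∧ e t' = Event.abaRound i r}.ncard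

/-- `i` has decided in ABA `r` by the time it completes `k` rounds. -/
def DecidesWithin (e : ℕ → Event f Msg V) (i : Proc f) (r k : ℕ) : Prop :=
  ∃ t b, e t = Event.abaOut i r b ∧ abaRounds e i r t ≤ k

/-- Termination of ABA, for a random event sequence `ρ`: in each instance (to which all correct
processes make an input) the probability that a correct process is undecided after `k` rounds tends
to zero as `k` tends to infinity. -/
def ABATermination (F : ℕ → Proc f) (B : ℕ) (C : Set (Proc f)) {Ω : Type*} [MeasurableSpace Ω]
    (μ : Measure Ω) (ρ : Ω → ℕ → Event f Msg V) : Prop :=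
  ∀ r, ∀ i ∈ C, Tendsto
    (fun k : ℕ => μ {ω | (∀ j ∈ C, ∃ t b, Does F B (ρ ω) j t (Action.abaIn r b)) ∧
      ¬ DecidesWithin (ρ ω) i r k})
    atTop (𝓝 0)

end Algorithm

end Alea

/-!
Every queue is a function of the outputs of its VCBC instances and of the set of delivered
proposals: a slot is empty, used up or full according to whether its instance has no output yet, an
output that has been delivered, or a new one (`slot_eq_expectedSlot`). The proposal at the head is
therefore the output of the first instance of the queue that is not in the set `D` of delivered
proposals, and can be seen only when the outputs of all lower slots are known and lie in `D`
(`FirstNew`). Heads of the same queue at two processes may be at different slots even when `D` is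
the same, since a process may not have learnt yet that a lower slot holds a delivered proposal; but
by consistency of VCBC, if both processes see a proposal at the head, it is the same one
(`FirstNew.unique`). With agreement of ABA, induction on the round shows that correct processes in
the same round have delivered the same messages and proposals (`delivered_eq_of_round_eq`).

It remains to see that no correct process is stuck in a round (`exists_round_eq`). ABA instances to
which all correct processes propose terminate almost surely, as there are countably many of them
(`ae_abaTerminates`). If the decision is `1`, then some correct process `k` has proposed `1` before,
so it has seen a proposal at the head, in slot `h`, say. A process `i` which sees none asks for the
slots from its own head on. That head is at most `h`, and `k`, whose own head can only have grown,
answers with verifiable messages for all slots from there to `h`, so that `i` obtains all outputs up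
to slot `h` and then sees the proposal as well (`exists_firstNew_of_fillGap`).
-/

namespace Alea

/-! ### Priority queues -/

namespace PQueue

variable {α : Type*}

lemma head_eq_of_forall_lt_removed {Q : PQueue α} {h : ℕ} (hh : Q.slot h ≠ Slot.removed)
    (hlt : ∀ s < h, Q.slot s = Slot.removed) : Q.head = h := by
  refine le_antisymm (Nat.sInf_le hh) ?_
  by_contra hcon
  exact Nat.sInf_mem (s := {s | Q.slot s ≠ Slot.removed}) ⟨h, hh⟩ (hlt _ (not_le.1 hcon))

lemma slot_eq_removed_of_lt_head {Q : PQueue α} {s : ℕ} (hs : s < Q.head) :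
    Q.slot s = Slot.removed := by
  by_contra hcon
  exact Nat.notMem_of_lt_sInf hs hcon

lemma peek_eq_some_iff {Q : PQueue α} {v : α} :
    Q.peek = some v ↔ ∃ h, Q.slot h = Slot.full v ∧ ∀ s < h, Q.slot s = Slot.removed := by
  constructor
  · intro hp
    refine ⟨Q.head, ?_, fun s hs => slot_eq_removed_of_lt_head hs⟩
    unfold peek at hp
    split at hp <;> simp_all
  · rintro ⟨h, hf, hlt⟩
    have hh : Q.head = h := head_eq_of_forall_lt_removed (by simp [hf]) hlt
    simp [peek, hh, hf]

end PQueue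

section Agreement

variable {f : ℕ} {Msg V : Type*} [DecidableEq Msg]
variable {F : ℕ → Proc f} {B : ℕ} {C : Set (Proc f)} {e : ℕ → Event f Msg V} {i : Proc f}

/-! ### Single steps of the local algorithm -/

lemma state_succ (t : ℕ) :
    state F B e i (t + 1) = (react F B i (state F B e i t) (e t)).1 := rfl

/-- The agreement loop alone changes the control location, the round and the set of deliveries. -/
lemma react_of_ne_loop {st : LocalState f Msg V} {ev : Event f Msg V} (h : ev ≠ Event.loop i) :
    (react F B i st ev).1.round = st.round ∧ (react F B i st ev).1.pc = st.pc ∧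
      (react F B i st ev).1.S = st.S ∧ (react F B i st ev).1.ordered = st.ordered := by
  cases ev with
  | loop i' =>
    have : i' ≠ i := fun hi => h (by rw [hi])
    simp [react, this]
  | client i' m =>
    simp only [react, onClient]
    split_ifs <;> simp
  | idle => simp [react]
  | abaRound => simp [react]
  | _ =>
    simp only [react, onVcbcOut]
    split_ifs <;> simp

lemma state_succ_of_loop {t : ℕ} (he : e t = Event.loop i) :
    state F B e i (t + 1) = (onLoop F (state F B e i t)).1 := by
  simp [state_succ, he, react]

lemma does_iff_of_loop {t : ℕ} (he : e t = Event.loop i) {a : Action f Msg V} :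
    Does F B e i t a ↔ a ∈ (onLoop F (state F B e i t)).2 := by
  simp [Does, he, react]

lemma react_vcbc (st : LocalState f Msg V) (ev : Event f Msg V) (id : VcbcId f) :
    (react F B i st ev).1.vcbc id = st.vcbc id ∨
      ∃ m M, ev = Event.vcbcOut i id m M ∧ (react F B i st ev).1.vcbc id = some (m, M) := by
  cases ev with
  | vcbcOut i' id' m M =>
    by_cases hi : i' = i
    · by_cases hid : id = id'
      · subst hi hid
        exact Or.inr ⟨m, M, rfl, by simp [react, onVcbcOut]⟩
      · left; simp [react, hi, onVcbcOut, hid]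
    · left; simp [react, hi]
  | client i' m =>
    left; simp only [react, onClient]
    split_ifs <;> simp
  | loop i' =>
    left; simp only [react, onLoop, acDeliver]
    (repeat' split) <;> simp
  | _ => left; simp only [react] <;> split_ifs <;> simp

lemma react_aba (st : LocalState f Msg V) (ev : Event f Msg V) (r : ℕ) :
    (react F B i st ev).1.aba r = st.aba r ∨
      ∃ b, ev = Event.abaOut i r b ∧ (react F B i st ev).1.aba r = some b := by
  cases ev with
  | abaOut i' r' b =>
    by_cases hi : i' = i
    · by_cases hr : r = r'
      · subst hi hr
        exact Or.inr ⟨b, rfl, by simp [react]⟩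
      · left; simp [react, hi, hr]
    · left; simp [react, hi]
  | client i' m =>
    left; simp only [react, onClient]
    split_ifs <;> simp
  | loop i' =>
    left; simp only [react, onLoop, acDeliver]
    (repeat' split) <;> simp
  | _ => left; simp only [react, onVcbcOut] <;> split_ifs <;> simp

/-! ### Local outputs of the building blocks -/

lemma exists_vcbcOut_of_vcbc {t : ℕ} {id : VcbcId f} {x : Finset Msg × V}
    (h : (state F B e i t).vcbc id = some x) :
    ∃ t' < t, e t' = Event.vcbcOut i id x.1 x.2 := by
  induction t with
  | zero => simp [state, LocalState.init] at h
  | succ t ih =>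
    rw [state_succ] at h
    rcases react_vcbc (F := F) (B := B) (i := i) (state F B e i t) (e t) id with h' | ⟨m, M, he, h'⟩
    · obtain ⟨t', ht', he⟩ := ih (h' ▸ h)
      exact ⟨t', by omega, he⟩
    · rw [h'] at h
      cases h
      exact ⟨t, by omega, he⟩

lemma vcbc_of_vcbcOut (hv : VCBC F B C e) (hi : i ∈ C) {t t' : ℕ} {id : VcbcId f}
    {m : Finset Msg} {M : V} (he : e t' = Event.vcbcOut i id m M) (ht : t' < t) :
    (state F B e i t).vcbc id = some (m, M) := by
  induction t with
  | zero => omega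
  | succ t ih =>
    rw [state_succ]
    rcases Nat.lt_succ_iff_lt_or_eq.1 ht with hlt | rfl
    · rcases react_vcbc (F := F) (B := B) (i := i) (state F B e i t) (e t) id with
        h' | ⟨m', M', he', -⟩
      · rw [h', ih hlt]
      · have := hv.integrity_once i hi id _ _ _ _ _ _ he he'
        omega
    · simp [he, react, onVcbcOut]

lemma vcbc_mono (hv : VCBC F B C e) (hi : i ∈ C) {t t' : ℕ} (htt : t ≤ t') {id : VcbcId f}
    {x : Finset Msg × V} (h : (state F B e i t).vcbc id = some x) :
    (state F B e i t').vcbc id = some x := by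
  obtain ⟨t₀, ht₀, he⟩ := exists_vcbcOut_of_vcbc h
  exact vcbc_of_vcbcOut hv hi he (by omega)

lemma vcbc_consistent (hv : VCBC F B C e) {j : Proc f} (hi : i ∈ C) (hj : j ∈ C) {t t' : ℕ}
    {id : VcbcId f} {x y : Finset Msg × V} (hx : (state F B e i t).vcbc id = some x)
    (hy : (state F B e j t').vcbc id = some y) : x.1 = y.1 := by
  obtain ⟨_, -, he⟩ := exists_vcbcOut_of_vcbc hx
  obtain ⟨_, -, he'⟩ := exists_vcbcOut_of_vcbc hy
  exact hv.consistency i hi j hj id _ _ _ _ _ _ he he'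

/-- Only finitely many VCBC instances have terminated at any time. -/
lemma finite_vcbc (t : ℕ) : {id | (state F B e i t).vcbc id ≠ none}.Finite := by
  induction t with
  | zero => simp [state, LocalState.init]
  | succ t ih =>
    by_cases he : ∃ id m M, e t = Event.vcbcOut i id m M
    · obtain ⟨id, m, M, he⟩ := he
      refine (ih.insert id).subset fun id' hid' => ?_
      rcases react_vcbc (F := F) (B := B) (i := i) (state F B e i t) (e t) id' with
        h' | ⟨m', M', he', -⟩
      · right
        rwa [Set.mem_ofPred_eq, state_succ, h'] at hid'
      · left
        rw [he] at he'
        simp_all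
    · refine ih.subset fun id' hid' => ?_
      rcases react_vcbc (F := F) (B := B) (i := i) (state F B e i t) (e t) id' with
        h' | ⟨m', M', he', -⟩
      · rwa [Set.mem_ofPred_eq, state_succ, h'] at hid'
      · exact absurd ⟨_, _, _, he'⟩ he

lemma exists_abaOut_of_aba {t r : ℕ} {b : Bool} (h : (state F B e i t).aba r = some b) :
    ∃ t' < t, e t' = Event.abaOut i r b := by
  induction t with
  | zero => simp [state, LocalState.init] at h
  | succ t ih =>
    rw [state_succ] at h
    rcases react_aba (F := F) (B := B) (i := i) (state F B e i t) (e t) r with h' | ⟨b', he, h'⟩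
    · obtain ⟨t', ht', he⟩ := ih (h' ▸ h)
      exact ⟨t', by omega, he⟩
    · rw [h'] at h
      cases h
      exact ⟨t, by omega, he⟩

lemma aba_of_abaOut (ha : ABASafety F B C e) (hi : i ∈ C) {t t' r : ℕ} {b : Bool}
    (he : e t' = Event.abaOut i r b) (ht : t' < t) : (state F B e i t).aba r = some b := by
  induction t with
  | zero => omega
  | succ t ih =>
    rw [state_succ]
    rcases Nat.lt_succ_iff_lt_or_eq.1 ht with hlt | rfl
    · rcases react_aba (F := F) (B := B) (i := i) (state F B e i t) (e t) r with
        h' | ⟨b', he', h'⟩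
      · rw [h', ih hlt]
      · rw [h', ha.agreement i hi i hi r _ _ _ _ he he']
    · simp [he, react]

lemma aba_consistent (ha : ABASafety F B C e) {j : Proc f} (hi : i ∈ C) (hj : j ∈ C)
    {t t' r : ℕ} {b b' : Bool} (hb : (state F B e i t).aba r = some b)
    (hb' : (state F B e j t').aba r = some b') : b = b' := by
  obtain ⟨_, -, he⟩ := exists_abaOut_of_aba hb
  obtain ⟨_, -, he'⟩ := exists_abaOut_of_aba hb'
  exact ha.agreement i hi j hj r _ _ _ _ he he'

/-! ### The contents of the queues -/

/-- What a slot must contain, given the output of its VCBC instance and the set of delivered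
proposals. -/
def expectedSlot (o : Option (Finset Msg × V)) (ord : Finset (Finset Msg)) : Slot (Finset Msg) :=
  match o with
  | none => Slot.empty
  | some x => if x.1 ∈ ord then Slot.removed else Slot.full x.1

/-- The queues carry no information beyond the VCBC outputs and the set of delivered proposals.
At-most-once output of VCBC matters here: a second output in the same instance would be recorded
without entering the queue. -/
lemma slot_eq_expectedSlot (hv : VCBC F B C e) (hi : i ∈ C) (t : ℕ) (q : Proc f) (s : ℕ) :
    ((state F B e i t).queues q).slot s =
      expectedSlot ((state F B e i t).vcbc (q, s)) (state F B e i t).ordered := by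
  induction t generalizing q s with
  | zero => simp [state, LocalState.init, PQueue.new, expectedSlot]
  | succ t ih =>
    rw [state_succ]
    cases he : e t with
    | vcbcOut i' id m M =>
      by_cases hii : i' = i
      · subst hii
        obtain ⟨q', s'⟩ := id
        have hnone : (state F B e i' t).vcbc (q', s') = none := by
          by_contra hcon
          obtain ⟨x, hx⟩ := Option.ne_none_iff_exists'.1 hcon
          obtain ⟨t', ht', he'⟩ := exists_vcbcOut_of_vcbc hx
          have := hv.integrity_once i' hi _ _ _ _ _ _ _ he he'
          omega
        have hslot := ih q s
        have hslot' := ih q' s'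
        rw [hnone] at hslot'
        simp only [expectedSlot] at hslot'
        simp only [react, if_true, onVcbcOut]
        by_cases hq : q = q'
        · subst hq
          by_cases hs : s = s'
          · subst hs
            by_cases hm : m ∈ (state F B e i' t).ordered <;>
              simp [hm, PQueue.enqueue, PQueue.dequeue, hslot', expectedSlot]
          · have hne : (q, s) ≠ (q, s') := by simp [hs]
            rw [Function.update_of_ne hne, ← hslot]
            by_cases hm : m ∈ (state F B e i' t).ordered
            · simp only [hm, if_true, Function.update_self, PQueue.enqueue, PQueue.dequeue,
                hs, if_false]
              rw [hslot]
              unfold expectedSlot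
              cases (state F B e i' t).vcbc (q, s) with
              | none => rfl
              | some x =>
                by_cases hx : x.1 ∈ (state F B e i' t).ordered
                · simp [hx]
                · have hxm : x.1 ≠ m := fun h => hx (h ▸ hm)
                  simp [hx, hxm]
            · simp [hm, PQueue.enqueue, hs]
        · have hne : (q, s) ≠ (q', s') := by simp [hq]
          rw [Function.update_of_ne hne, Function.update_of_ne hq, hslot]
      · simpa [react, hii] using ih q s
    | loop i' =>
      by_cases hii : i' = i
      · subst hii
        simp only [react, if_true, onLoop]
        (repeat' split) <;> try exact ih q s
        simp only [acDeliver, PQueue.dequeue, ih q s, expectedSlot]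
        cases (state F B e i' t).vcbc (q, s) with
        | none => rfl
        | some x => by_cases hx : x.1 ∈ (state F B e i' t).ordered <;> simp [hx]
      · simpa [react, hii] using ih q s
    | client i' m =>
      simp only [react, onClient]
      split_ifs <;> exact ih q s
    | idle => exact ih q s
    | abaRound => exact ih q s
    | _ =>
      simp only [react]
      split_ifs <;> exact ih q s

lemma slot_eq_full_iff (hv : VCBC F B C e) (hi : i ∈ C) {t : ℕ} {q : Proc f} {s : ℕ}
    {v : Finset Msg} : ((state F B e i t).queues q).slot s = Slot.full v ↔
      v ∉ (state F B e i t).ordered ∧ ∃ M, (state F B e i t).vcbc (q, s) = some (v, M) := by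
  rw [slot_eq_expectedSlot hv hi]
  unfold expectedSlot
  cases (state F B e i t).vcbc (q, s) with
  | none => simp
  | some x =>
    obtain ⟨w, M⟩ := x
    by_cases hx : w ∈ (state F B e i t).ordered <;> (simp [hx]; grind)

lemma slot_eq_removed_iff (hv : VCBC F B C e) (hi : i ∈ C) {t : ℕ} {q : Proc f} {s : ℕ} :
    ((state F B e i t).queues q).slot s = Slot.removed ↔
      ∃ x, (state F B e i t).vcbc (q, s) = some x ∧ x.1 ∈ (state F B e i t).ordered := by
  rw [slot_eq_expectedSlot hv hi]
  unfold expectedSlot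
  cases (state F B e i t).vcbc (q, s) with
  | none => simp
  | some x => by_cases hx : x.1 ∈ (state F B e i t).ordered <;> simp [hx]

/-- `i` knows at time `t` the outputs of `VCBC (q, s)` for all `s ≤ h`; the one for `h` is `v`, which
is not in `D`, and those for `s < h` are in `D`. -/
def FirstNew (F : ℕ → Proc f) (B : ℕ) (e : ℕ → Event f Msg V) (i : Proc f) (t : ℕ) (q : Proc f)
    (D : Finset (Finset Msg)) (h : ℕ) (v : Finset Msg) : Prop :=
  v ∉ D ∧ (∃ M, (state F B e i t).vcbc (q, h) = some (v, M)) ∧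
    ∀ s < h, ∃ x, (state F B e i t).vcbc (q, s) = some x ∧ x.1 ∈ D

lemma peek_eq_some_iff_firstNew (hv : VCBC F B C e) (hi : i ∈ C) {t : ℕ} {q : Proc f}
    {v : Finset Msg} : ((state F B e i t).queues q).peek = some v ↔
      ∃ h, FirstNew F B e i t q (state F B e i t).ordered h v := by
  simp only [PQueue.peek_eq_some_iff, slot_eq_full_iff hv hi, slot_eq_removed_iff hv hi, FirstNew,
    and_assoc]

lemma FirstNew.mono (hv : VCBC F B C e) (hi : i ∈ C) {t t' : ℕ} {q : Proc f}
    {D : Finset (Finset Msg)} {h : ℕ} {v : Finset Msg} (hn : FirstNew F B e i t q D h v)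
    (htt : t ≤ t') : FirstNew F B e i t' q D h v := by
  obtain ⟨h1, ⟨M, h2⟩, h3⟩ := hn
  refine ⟨h1, ⟨M, vcbc_mono hv hi htt h2⟩, fun s hs => ?_⟩
  obtain ⟨x, hx, hxD⟩ := h3 s hs
  exact ⟨x, vcbc_mono hv hi htt hx, hxD⟩

/-- Consistency of VCBC makes the first new proposal of a queue the same for all correct
processes. -/
lemma FirstNew.unique (hv : VCBC F B C e) {j : Proc f} (hi : i ∈ C) (hj : j ∈ C) {t t' : ℕ}
    {q : Proc f} {D : Finset (Finset Msg)} {h h' : ℕ} {v v' : Finset Msg}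
    (hn : FirstNew F B e i t q D h v) (hn' : FirstNew F B e j t' q D h' v') : v = v' := by
  obtain ⟨h1, ⟨M, h2⟩, h3⟩ := hn
  obtain ⟨h1', ⟨M', h2'⟩, h3'⟩ := hn'
  rcases lt_trichotomy h h' with hlt | rfl | hlt
  · obtain ⟨x, hx, hxD⟩ := h3' h hlt
    have hvx : v = x.1 := vcbc_consistent hv hi hj h2 hx
    exact absurd (hvx ▸ hxD) h1
  · exact vcbc_consistent hv hi hj h2 h2'
  · obtain ⟨x, hx, hxD⟩ := h3 h' hlt
    have hvx : v' = x.1 := vcbc_consistent hv hj hi h2' hx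
    exact absurd (hvx ▸ hxD) h1'

/-! ### Agreement on the delivered sets, round by round -/

lemma aba_eq_true_of_waitHead (ha : ABASafety F B C e) (hi : i ∈ C) {t : ℕ}
    (hpc : (state F B e i t).pc = Pc.waitHead) :
    (state F B e i t).aba (state F B e i t).round = some true := by
  induction t with
  | zero => simp [state, LocalState.init] at hpc
  | succ t ih =>
    have key : ∀ r, (state F B e i t).aba r = some true →
        (state F B e i (t + 1)).aba r = some true := fun r hr => by
      obtain ⟨t', ht', he⟩ := exists_abaOut_of_aba hr
      exact aba_of_abaOut ha hi he (by omega)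
    by_cases he : e t = Event.loop i
    · have hst : state F B e i (t + 1) = (onLoop F (state F B e i t)).1 := by
        simp [state_succ, he, react]
      have hround : (state F B e i (t + 1)).round = (state F B e i t).round ∧
          (state F B e i t).aba (state F B e i t).round = some true := by
        rw [hst] at hpc ⊢
        cases hpc' : (state F B e i t).pc with
        | top => simp [onLoop, hpc'] at hpc
        | waitDecision =>
          rcases haba : (state F B e i t).aba (state F B e i t).round with _ | _ | _ <;>
            simp [onLoop, hpc', haba] at hpc ⊢
        | waitHead =>
          rcases hp : ((state F B e i t).queues (F (state F B e i t).round)).peek with _ | v <;>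
            simp [onLoop, hpc', hp, acDeliver] at hpc ⊢
          exact ih hpc'
      rw [hround.1]
      exact key _ hround.2
    · obtain ⟨h1, h2, -, -⟩ := react_of_ne_loop (F := F) (B := B) (st := state F B e i t) he
      rw [← state_succ] at h1 h2
      rw [h1]
      exact key _ (ih (h2 ▸ hpc))

/-- At time `t`, process `i` is in round `r` and knows the decision `0` of this round, which makes it
go on to the next round without a delivery. -/
def Skips (F : ℕ → Proc f) (B : ℕ) (e : ℕ → Event f Msg V) (i : Proc f) (t r : ℕ) : Prop :=
  (state F B e i t).round = r ∧ (state F B e i t).aba r = some false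

/-- At time `t`, process `i` is in round `r`, knows the decision `1` of this round, sees the proposal
`v` at the head of the queue of this round, and outputs those messages of `v` that it has not
delivered before. -/
def DeliversProposal (F : ℕ → Proc f) (B : ℕ) (e : ℕ → Event f Msg V) (i : Proc f) (t r : ℕ)
    (v : Finset Msg) : Prop :=
  (state F B e i t).round = r ∧ (state F B e i t).aba r = some true ∧
    ((state F B e i t).queues (F r)).peek = some v ∧
    ∀ m ∈ v, m ∉ (state F B e i t).S → Does F B e i t (Action.output m)

/-- The round, the delivered messages and the delivered proposals change together, when a round is
completed. -/
lemma round_step (ha : ABASafety F B C e) (hi : i ∈ C) (t : ℕ) :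
    let st := state F B e i t
    let st' := state F B e i (t + 1)
    (st'.round = st.round ∧ st'.S = st.S ∧ st'.ordered = st.ordered) ∨
    (st'.round = st.round + 1 ∧ Skips F B e i t st.round ∧ st'.S = st.S ∧
      st'.ordered = st.ordered) ∨
    (st'.round = st.round + 1 ∧ ∃ v, DeliversProposal F B e i t st.round v ∧ st'.S = st.S ∪ v ∧
      st'.ordered = st.ordered ∪ {v}) := by
  intro st st'
  by_cases he : e t = Event.loop i
  · have hst : st' = (onLoop F st).1 := by
      simp [st', st, state_succ, he, react]
    have hdoes : ∀ a, Does F B e i t a ↔ a ∈ (onLoop F st).2 := by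
      intro a
      simp [Does, st, he, react]
    cases hpc : st.pc with
    | top =>
      left
      rw [hst]
      simp [onLoop, hpc]
    | waitDecision =>
      rcases haba : st.aba st.round with _ | _ | _
      · left; rw [hst]; simp [onLoop, hpc, haba]
      · right; left
        rw [hst]
        refine ⟨?_, ⟨rfl, haba⟩, ?_, ?_⟩ <;> simp [onLoop, hpc, haba]
      · left; rw [hst]; simp [onLoop, hpc, haba]
    | waitHead =>
      rcases hp : (st.queues (F st.round)).peek with _ | v
      · left; rw [hst]; simp [onLoop, hpc, hp]
      · right; right
        refine ⟨by rw [hst]; simp [onLoop, hpc, hp, acDeliver], v,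
          ⟨rfl, aba_eq_true_of_waitHead ha hi hpc, hp, fun m hm hS => ?_⟩, ?_, ?_⟩
        · rw [does_iff_of_loop he]
          change _ ∈ (onLoop F st).2
          simpa [onLoop, hpc, hp, acDeliver] using ⟨hm, hS⟩
        · rw [hst]; simp [onLoop, hpc, hp, acDeliver]
        · rw [hst]; simp [onLoop, hpc, hp, acDeliver]
  · left
    obtain ⟨h1, -, h3, h4⟩ := react_of_ne_loop (F := F) (B := B) (st := st) he
    exact ⟨h1, h3, h4⟩

lemma delivered_eq_empty_of_round_eq_zero (ha : ABASafety F B C e) (hi : i ∈ C) {t : ℕ}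
    (hr : (state F B e i t).round = 0) :
    (state F B e i t).S = ∅ ∧ (state F B e i t).ordered = ∅ := by
  induction t with
  | zero => simp [state, LocalState.init]
  | succ t ih =>
    rcases round_step ha hi t with ⟨h1, h2, h3⟩ | ⟨h1, -⟩ | ⟨h1, -⟩
    · rw [h2, h3]
      exact ih (h1 ▸ hr)
    · omega
    · omega

lemma exists_completion_of_round_eq_succ (ha : ABASafety F B C e) (hi : i ∈ C) {t r : ℕ}
    (hr : (state F B e i t).round = r + 1) :
    ∃ t₀, (Skips F B e i t₀ r ∧ (state F B e i t).S = (state F B e i t₀).S ∧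
        (state F B e i t).ordered = (state F B e i t₀).ordered) ∨
      ∃ v, DeliversProposal F B e i t₀ r v ∧ (state F B e i t).S = (state F B e i t₀).S ∪ v ∧
        (state F B e i t).ordered = (state F B e i t₀).ordered ∪ {v} := by
  induction t with
  | zero => simp [state, LocalState.init] at hr
  | succ t ih =>
    rcases round_step ha hi t with ⟨h1, h2, h3⟩ | ⟨h1, h2, h3⟩ | ⟨h1, h2⟩
    · rw [h2, h3]
      exact ih (h1 ▸ hr)
    · obtain rfl : (state F B e i t).round = r := by omega
      exact ⟨t, Or.inl ⟨h2, h3⟩⟩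
    · obtain rfl : (state F B e i t).round = r := by omega
      exact ⟨t, Or.inr h2⟩

/-- Whenever two correct processes are in the same round, they have delivered the same messages and
the same proposals. -/
theorem delivered_eq_of_round_eq (hv : VCBC F B C e) (ha : ABASafety F B C e) {r : ℕ} :
    ∀ {i j : Proc f}, i ∈ C → j ∈ C → ∀ {t t' : ℕ}, (state F B e i t).round = r →
      (state F B e j t').round = r →
      (state F B e i t).S = (state F B e j t').S ∧
        (state F B e i t).ordered = (state F B e j t').ordered := by
  induction r with
  | zero =>
    intro i j hi hj t t' h h'
    obtain ⟨h1, h2⟩ := delivered_eq_empty_of_round_eq_zero ha hi h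
    obtain ⟨h1', h2'⟩ := delivered_eq_empty_of_round_eq_zero ha hj h'
    exact ⟨h1.trans h1'.symm, h2.trans h2'.symm⟩
  | succ r ih =>
    intro i j hi hj t t' h h'
    obtain ⟨t₀, h₀⟩ := exists_completion_of_round_eq_succ ha hi h
    obtain ⟨t₁, h₁⟩ := exists_completion_of_round_eq_succ ha hj h'
    rcases h₀ with ⟨⟨hr, hb⟩, hS, hD⟩ | ⟨v, ⟨hr, hb, hp, -⟩, hS, hD⟩ <;>
    rcases h₁ with ⟨⟨hr', hb'⟩, hS', hD'⟩ | ⟨v', ⟨hr', hb', hp', -⟩, hS', hD'⟩ <;>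
    obtain ⟨hSS, hDD⟩ := ih hi hj hr hr'
    · rw [hS, hD, hS', hD']
      exact ⟨hSS, hDD⟩
    · exact absurd (aba_consistent ha hi hj hb hb') (by simp)
    · exact absurd (aba_consistent ha hi hj hb hb') (by simp)
    · obtain ⟨_, hn⟩ := (peek_eq_some_iff_firstNew hv hi).1 hp
      obtain ⟨_, hn'⟩ := (peek_eq_some_iff_firstNew hv hj).1 hp'
      rw [← hDD] at hn'
      obtain rfl := FirstNew.unique hv hi hj hn hn'
      rw [hS, hD, hS', hD', hSS, hDD]
      exact ⟨rfl, rfl⟩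

lemma ordered_mono (ha : ABASafety F B C e) (hi : i ∈ C) {t t' : ℕ} (htt : t ≤ t') :
    (state F B e i t).ordered ⊆ (state F B e i t').ordered := by
  induction htt with
  | refl => exact subset_rfl
  | @step t' _ ih =>
    refine ih.trans ?_
    rcases round_step ha hi t' with ⟨-, -, h⟩ | ⟨-, -, -, h⟩ | ⟨-, v, -, -, h⟩ <;> rw [h]
    exact Finset.subset_union_left

/-! ### The agreement loop makes progress -/

/-- Termination of ABA in a single execution: if all correct processes propose, all of them
decide. -/
def ABATerminates (F : ℕ → Proc f) (B : ℕ) (C : Set (Proc f)) (e : ℕ → Event f Msg V) : Prop :=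
  ∀ r, ∀ i ∈ C, (∀ j ∈ C, ∃ t b, Does F B e j t (Action.abaIn r b)) →
    ∃ t b, e t = Event.abaOut i r b

/-- The waiting principle: if the loop of `i` is at `pc` in round `r`, can leave this point only
when `P` holds, and `P` holds from some time on as long as the loop stays there, then the loop is
at some time scheduled at this point while `P` holds. -/
lemma exists_loop_of_eventually (hfair : ∀ t, ∃ t' ≥ t, e t' = Event.loop i) (P : ℕ → Prop)
    {t r : ℕ} {pc : Pc} (hr : (state F B e i t).round = r) (hpc : (state F B e i t).pc = pc)
    (hP : ∃ T, ∀ t' ≥ T, (state F B e i t').round = r → P t')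
    (hstay : ∀ t', (state F B e i t').round = r → (state F B e i t').pc = pc → ¬ P t' →
      (onLoop F (state F B e i t')).1 = state F B e i t') :
    ∃ t' ≥ t, e t' = Event.loop i ∧ (state F B e i t').round = r ∧
      (state F B e i t').pc = pc ∧ P t' := by
  by_contra! hcon
  have stay : ∀ t' ≥ t, (state F B e i t').round = r ∧ (state F B e i t').pc = pc := by
    intro t' ht'
    induction ht' with
    | refl => exact ⟨hr, hpc⟩
    | @step t' ht' ih =>
      by_cases he : e t' = Event.loop i
      · change (state F B e i (t' + 1)).round = r ∧ (state F B e i (t' + 1)).pc = pc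
        rw [state_succ_of_loop he, hstay t' ih.1 ih.2 (hcon t' ht' he ih.1 ih.2)]
        exact ih
      · obtain ⟨h1, h2, -, -⟩ := react_of_ne_loop (F := F) (B := B) (st := state F B e i t') he
        exact ⟨h1.trans ih.1, h2.trans ih.2⟩
  obtain ⟨T, hT⟩ := hP
  obtain ⟨t', ht', he⟩ := hfair (max t T)
  obtain ⟨h1, h2⟩ := stay t' (by omega)
  exact hcon t' (by omega) he h1 h2 (hT t' (by omega) h1)

lemma exists_propose (hfair : ∀ t, ∃ t' ≥ t, e t' = Event.loop i) {t r : ℕ}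
    (hr : (state F B e i t).round = r) (hpc : (state F B e i t).pc = Pc.top) :
    ∃ t', (∃ b, Does F B e i t' (Action.abaIn r b)) ∧
      (state F B e i (t' + 1)).round = r ∧ (state F B e i (t' + 1)).pc = Pc.waitDecision := by
  obtain ⟨t', -, he, hr', hpc', -⟩ :=
    exists_loop_of_eventually hfair (fun _ => True) hr hpc ⟨0, by simp⟩ (by simp)
  refine ⟨t', ⟨((state F B e i t').queues (F r)).peek.isSome, ?_⟩, ?_⟩
  · rw [does_iff_of_loop he]
    simp [onLoop, hpc', hr']
  · rw [state_succ_of_loop he]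
    simp [onLoop, hpc', hr']

lemma round_and_peek_of_does_abaIn {t r : ℕ} {b : Bool} (h : Does F B e i t (Action.abaIn r b)) :
    (state F B e i t).round = r ∧ ((state F B e i t).queues (F r)).peek.isSome = b := by
  unfold Does at h
  cases he : e t with
  | loop i' =>
    by_cases hii : i' = i
    · subst hii
      simp only [he, react, if_true] at h
      cases hpc : (state F B e i' t).pc with
      | top =>
        simp only [onLoop, hpc, Set.mem_singleton_iff, Action.abaIn.injEq] at h
        obtain ⟨rfl, rfl⟩ := h
        exact ⟨rfl, rfl⟩
      | waitDecision =>
        rcases haba : (state F B e i' t).aba (state F B e i' t).round with _ | _ | _ <;>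
          simp [onLoop, hpc, haba] at h
      | waitHead =>
        rcases hp : ((state F B e i' t).queues (F (state F B e i' t).round)).peek with _ | v <;>
          simp [onLoop, hpc, hp, acDeliver] at h
    · simp [he, react, hii] at h
  | client i' m =>
    simp only [he, react, onClient] at h
    split_ifs at h <;> simp at h
  | recv i' j x =>
    cases x <;> (simp only [he, react, onRecv] at h; split_ifs at h <;> simp at h)
  | idle => simp [he, react] at h
  | abaRound => simp [he, react] at h
  | _ =>
    simp only [he, react] at h
    split_ifs at h <;> simp at h

lemma exists_peek_of_does_output {t : ℕ} {m : Msg} (h : Does F B e i t (Action.output m)) :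
    (state F B e i t).pc = Pc.waitHead ∧ m ∉ (state F B e i t).S ∧ ∃ v, m ∈ v ∧
      ((state F B e i t).queues (F (state F B e i t).round)).peek = some v := by
  unfold Does at h
  cases he : e t with
  | loop i' =>
    by_cases hii : i' = i
    · subst hii
      simp only [he, react, if_true] at h
      cases hpc : (state F B e i' t).pc with
      | top => simp [onLoop, hpc] at h
      | waitDecision =>
        rcases haba : (state F B e i' t).aba (state F B e i' t).round with _ | _ | _ <;>
          simp [onLoop, hpc, haba] at h
      | waitHead =>
        rcases hp : ((state F B e i' t).queues (F (state F B e i' t).round)).peek with _ | v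
        · simp [onLoop, hpc, hp] at h
        · have h' : m ∈ v ∧ m ∉ (state F B e i' t).S := by
            simpa [onLoop, hpc, hp, acDeliver] using h
          exact ⟨rfl, h'.2, v, h'.1, rfl⟩
    · simp [he, react, hii] at h
  | client i' m =>
    simp only [he, react, onClient] at h
    split_ifs at h <;> simp at h
  | recv i' j x =>
    cases x <;> (simp only [he, react, onRecv] at h; split_ifs at h <;> simp at h)
  | idle => simp [he, react] at h
  | abaRound => simp [he, react] at h
  | _ =>
    simp only [he, react] at h
    split_ifs at h <;> simp at h

/-! ### Recovery of missing proposals -/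

lemma head_le_of_firstNew (hv : VCBC F B C e) {k : Proc f} (hi : i ∈ C) (hk : k ∈ C) {t t' : ℕ}
    {q : Proc f} {h : ℕ} {v : Finset Msg}
    (hn : FirstNew F B e k t' q (state F B e i t).ordered h v) :
    ((state F B e i t).queues q).head ≤ h := by
  obtain ⟨h1, ⟨M, h2⟩, -⟩ := hn
  refine Nat.sInf_le fun hrem => ?_
  obtain ⟨x, hx, hxD⟩ := (slot_eq_removed_iff hv hi).1 hrem
  have hvx : v = x.1 := vcbc_consistent hv hk hi h2 hx
  exact h1 (hvx ▸ hxD)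

lemma le_head_of_firstNew (hv : VCBC F B C e) (hi : i ∈ C) {t : ℕ} {q : Proc f}
    {D : Finset (Finset Msg)} {h : ℕ} {v : Finset Msg} (hn : FirstNew F B e i t q D h v)
    (hD : D ⊆ (state F B e i t).ordered) : h ≤ ((state F B e i t).queues q).head := by
  by_contra! hlt
  -- A queue with no head would have the junk value `0`; only finitely many slots are used.
  have hne : {s | ((state F B e i t).queues q).slot s ≠ Slot.removed}.Nonempty := by
    have hfin : {s | (state F B e i t).vcbc (q, s) ≠ none}.Finite :=
      (finite_vcbc (F := F) (B := B) (e := e) (i := i) t).preimage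
        (f := fun s => (q, s)) (Prod.mk_right_injective q).injOn
    obtain ⟨s, hs⟩ := hfin.exists_notMem
    refine ⟨s, fun hrem => ?_⟩
    obtain ⟨x, hx, -⟩ := (slot_eq_removed_iff hv hi).1 hrem
    exact hs (by simp [hx])
  obtain ⟨x, hx, hxD⟩ := hn.2.2 _ hlt
  exact Nat.sInf_mem hne ((slot_eq_removed_iff hv hi).2 ⟨x, hx, hD hxD⟩)

/-- The first new proposal at `k` becomes the first new proposal at `i` once `i` has the outputs of
the instances up to its slot. -/
lemma FirstNew.transfer (hv : VCBC F B C e) {k : Proc f} (hi : i ∈ C) (hk : k ∈ C) {t : ℕ}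
    {q : Proc f} {D : Finset (Finset Msg)} {h : ℕ} {v : Finset Msg}
    (hn : FirstNew F B e k t q D h v)
    (hout : ∀ s ≤ h, ∃ T x, (state F B e i T).vcbc (q, s) = some x) :
    ∃ T, FirstNew F B e i T q D h v := by
  obtain ⟨h1, ⟨M, h2⟩, h3⟩ := hn
  have : Nonempty (Finset Msg × V) := ⟨(v, M)⟩
  choose! g x hg using hout
  have hT : ∀ s ≤ h,
      (state F B e i ((Finset.range (h + 1)).sup g)).vcbc (q, s) = some (x s) := fun s hs =>
    vcbc_mono hv hi (Finset.le_sup (f := g) (Finset.mem_range.2 (by omega))) (hg s hs)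
  refine ⟨_, h1, ⟨(x h).2, ?_⟩, fun s hs => ⟨x s, hT s hs.le, ?_⟩⟩
  · have hvx : v = (x h).1 := vcbc_consistent hv hk hi h2 (hT h le_rfl)
    rw [hT h le_rfl, hvx]
  · obtain ⟨y, hy, hyD⟩ := h3 s hs
    rwa [vcbc_consistent hv hi hk (hT s hs.le) hy]

/-- When `i` asks for the proposals from its head on, `k` has a new proposal `v` in the slot `h` of
this queue and has outputs for all lower slots. The answer of `k` covers the slots from the head of
`i` to `h`, and verifiability yields their outputs at `i`. -/
lemma exists_firstNew_of_fillGap (hx : IsExecution F B C e) {k : Proc f} (hi : i ∈ C) (hk : k ∈ C)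
    {t t' : ℕ} (htt : t' ≤ t) {q : Proc f} {h : ℕ} {v : Finset Msg}
    (hn : FirstNew F B e k t' q (state F B e i t).ordered h v)
    (hD : (state F B e i t).ordered ⊆ (state F B e k t').ordered)
    (hsend : Does F B e i t
      (Action.send k (NetMsg.fillGap q ((state F B e i t).queues q).head))) :
    ∃ T, FirstNew F B e i T q (state F B e i t).ordered h v := by
  have hv := hx.vcbc
  obtain ⟨t₁, ht₁, he₁⟩ := hx.channels.eventual_delivery k hk i hi _ t hsend
  have hn₁ := hn.mono hv hk (t' := t₁) (by omega)
  have hle := head_le_of_firstNew hv hi hk hn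
  have hle₁ := le_head_of_firstNew hv hk hn₁
    (hD.trans (ordered_mono hx.aba hk (by omega)))
  have hfill : Does F B e k t₁ (Action.send i (NetMsg.filler
      (fillerEntries (state F B e k t₁) q ((state F B e i t).queues q).head
        ((state F B e k t₁).queues q).head))) := by
    simp only [Does, he₁, react, if_true, onRecv]
    exact ⟨hle.trans hle₁, rfl⟩
  obtain ⟨t₂, ht₂, he₂⟩ := hx.channels.eventual_delivery i hi k hk _ t₁ hfill
  refine hn.transfer hv hi hk fun s hs => ?_
  rcases lt_or_ge s ((state F B e i t).queues q).head with hlt | hge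
  · obtain ⟨x, hx', -⟩ := (slot_eq_removed_iff hv hi).1 (PQueue.slot_eq_removed_of_lt_head hlt)
    exact ⟨t, x, hx'⟩
  · obtain ⟨x, hxs⟩ : ∃ x, (state F B e k t₁).vcbc (q, s) = some x := by
      rcases hs.lt_or_eq with hlt | rfl
      · obtain ⟨x, hxs, -⟩ := hn₁.2.2 s hlt
        exact ⟨x, hxs⟩
      · obtain ⟨M, hM⟩ := hn₁.2.1
        exact ⟨_, hM⟩
    have hmsg : Does F B e i t₂ (Action.vcbcMsg (q, s) x.2) := by
      simp only [Does, he₂, react, if_true, onRecv]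
      refine ⟨((q, s), x.2), ?_, rfl⟩
      refine List.mem_filterMap.2 ⟨s, ?_, by simp [hxs]⟩
      rw [List.mem_range'_1]
      omega
    obtain ⟨t₃, ht₃, he₃⟩ := exists_vcbcOut_of_vcbc hxs
    obtain ⟨t₄, M, he₄⟩ := hv.verifiability k hk i hi _ _ _ _ _ he₃ (by omega) hmsg
    exact ⟨t₄ + 1, _, vcbc_of_vcbcOut hv hi he₄ (by omega)⟩

/-! ### Agreement in an execution with terminating ABA instances -/

/-- Every correct process completes every round. -/
theorem exists_round_eq (hx : IsExecution F B C e) (hterm : ABATerminates F B C e) (r : ℕ) :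
    ∀ i ∈ C, ∃ t, (state F B e i t).round = r ∧ (state F B e i t).pc = Pc.top := by
  have hv := hx.vcbc
  have ha := hx.aba
  induction r with
  | zero => exact fun i _ => ⟨0, rfl, rfl⟩
  | succ r ih =>
    intro i hi
    have hprop : ∀ j ∈ C, ∃ t b, Does F B e j t (Action.abaIn r b) := fun j hj => by
      obtain ⟨t, h1, h2⟩ := ih j hj
      obtain ⟨t', h, -⟩ := exists_propose (hx.fair j hj) h1 h2
      exact ⟨t', h⟩
    obtain ⟨t₀, h1, h2⟩ := ih i hi
    obtain ⟨t₁, -, hr₁, hpc₁⟩ := exists_propose (hx.fair i hi) h1 h2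
    obtain ⟨tb, b, heb⟩ := hterm r i hi hprop
    obtain ⟨t₂, -, he₂, hr₂, hpc₂, haba⟩ :=
      exists_loop_of_eventually (hx.fair i hi) (fun t => ∃ b, (state F B e i t).aba r = some b)
        hr₁ hpc₁ ⟨tb + 1, fun t' ht' _ => ⟨b, aba_of_abaOut ha hi heb (by omega)⟩⟩
        (fun t' hr hpc hP => by
          have hnone : (state F B e i t').aba (state F B e i t').round = none := by
            rw [hr]
            exact Option.eq_none_iff_forall_ne_some.2 fun b hb => hP ⟨b, hb⟩
          simp [onLoop, hpc, hnone])
    obtain ⟨b, haba⟩ := haba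
    cases b with
    | false =>
      refine ⟨t₂ + 1, ?_⟩
      rw [state_succ_of_loop he₂]
      simp [onLoop, hpc₂, hr₂, haba]
    | true =>
      have hwait : (state F B e i (t₂ + 1)).round = r ∧
          (state F B e i (t₂ + 1)).pc = Pc.waitHead := by
        rw [state_succ_of_loop he₂]
        simp [onLoop, hpc₂, hr₂, haba]
      -- By validity of ABA, some correct `k` has seen a proposal at the head before.
      obtain ⟨t₃, ht₃, he₃⟩ := exists_abaOut_of_aba haba
      obtain ⟨k, hk, t₄, ht₄, hin⟩ := ha.validity i hi r true t₃ he₃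
      obtain ⟨hr₄, hpeek⟩ := round_and_peek_of_does_abaIn hin
      have hDD := (delivered_eq_of_round_eq hv ha hi hk hr₂ hr₄).2
      obtain ⟨T, h, v, hT⟩ : ∃ T h v,
          FirstNew F B e i T (F r) (state F B e i t₂).ordered h v := by
        rcases hp : ((state F B e i t₂).queues (F r)).peek with _ | w
        · obtain ⟨v, hv'⟩ := Option.isSome_iff_exists.1 hpeek
          obtain ⟨h, hn⟩ := (peek_eq_some_iff_firstNew hv hk).1 hv'
          rw [← hDD] at hn
          obtain ⟨T, hT⟩ := exists_firstNew_of_fillGap hx hi hk (by omega) hn hDD.subset (by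
            rw [does_iff_of_loop he₂]
            simp [onLoop, hpc₂, hr₂, haba, hp])
          exact ⟨T, h, v, hT⟩
        · obtain ⟨h, hn⟩ := (peek_eq_some_iff_firstNew hv hi).1 hp
          exact ⟨t₂, h, w, hn⟩
      obtain ⟨t₅, -, he₅, hr₅, hpc₅, w, hw⟩ :=
        exists_loop_of_eventually (hx.fair i hi)
          (fun t => ∃ w, ((state F B e i t).queues (F r)).peek = some w) hwait.1 hwait.2
          ⟨T, fun t' ht' hr' => ⟨v, (peek_eq_some_iff_firstNew hv hi).2 ⟨h, by
            rw [(delivered_eq_of_round_eq hv ha hi hi hr' hr₂).2]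
            exact hT.mono hv hi ht'⟩⟩⟩
          (fun t' hr hpc hP => by
            have hnone : ((state F B e i t').queues (F (state F B e i t').round)).peek = none := by
              rw [hr]
              exact Option.eq_none_iff_forall_ne_some.2 fun b hb => hP ⟨b, hb⟩
            simp [onLoop, hpc, hnone])
      refine ⟨t₅ + 1, ?_⟩
      rw [state_succ_of_loop he₅]
      simp [onLoop, hpc₅, hr₅, hw, acDeliver]

theorem delivers_of_delivers (hx : IsExecution F B C e) (hterm : ABATerminates F B C e)
    {j : Proc f} (hi : i ∈ C) (hj : j ∈ C) {m : Msg} (h : Delivers F B e i m) :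
    Delivers F B e j m := by
  have hv := hx.vcbc
  have ha := hx.aba
  obtain ⟨t, ht⟩ := h
  obtain ⟨hpc, hS, v, hmv, hp⟩ := exists_peek_of_does_output ht
  have haba := aba_eq_true_of_waitHead ha hi hpc
  obtain ⟨t', hr', -⟩ := exists_round_eq hx hterm ((state F B e i t).round + 1) j hj
  obtain ⟨t₀, ⟨⟨-, hb⟩, -⟩ | ⟨w, ⟨hr, -, hp', hout⟩, -⟩⟩ :=
    exists_completion_of_round_eq_succ ha hj hr'
  · exact absurd (aba_consistent ha hi hj haba hb) (by simp)
  · obtain ⟨hSS, hDD⟩ := delivered_eq_of_round_eq hv ha hi hj rfl hr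
    obtain ⟨_, hn⟩ := (peek_eq_some_iff_firstNew hv hi).1 hp
    obtain ⟨_, hn'⟩ := (peek_eq_some_iff_firstNew hv hj).1 hp'
    rw [← hDD] at hn'
    obtain rfl := FirstNew.unique hv hi hj hn hn'
    exact ⟨t₀, hout m hmv (hSS ▸ hS)⟩

/-! ### Almost sure termination of all ABA instances -/

lemma ae_abaTerminates {Ω : Type*} [MeasurableSpace Ω] {μ : Measure Ω}
    {ρ : Ω → ℕ → Event f Msg V} (hterm : ABATermination F B C μ ρ) :
    ∀ᵐ ω ∂μ, ABATerminates F B C (ρ ω) := by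
  simp only [ABATerminates]
  rw [ae_all_iff]
  intro r
  rw [ae_all_iff]
  intro i
  by_cases hi : i ∈ C
  · -- Being undecided for ever implies being undecided after `k` rounds, for every `k`.
    have hle : ∀ k, μ {ω | (∀ j ∈ C, ∃ t b, Does F B (ρ ω) j t (Action.abaIn r b)) ∧
          ¬ ∃ t b, ρ ω t = Event.abaOut i r b} ≤
        μ {ω | (∀ j ∈ C, ∃ t b, Does F B (ρ ω) j t (Action.abaIn r b)) ∧
          ¬ DecidesWithin (ρ ω) i r k} := fun k =>
      measure_mono fun ω hω => ⟨hω.1, fun ⟨t, b, h, _⟩ => hω.2 ⟨t, b, h⟩⟩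
    rw [ae_iff]
    refine measure_mono_null (fun ω hω => ?_)
      (le_antisymm (ge_of_tendsto' (hterm r i hi) hle) bot_le)
    simpa [hi] using hω
  · simp [hi]

end Agreement

end Alea

theorem mainTheorem1 {f : ℕ} {Msg V : Type*} [DecidableEq Msg]
    (B : ℕ) (F : ℕ → Alea.Proc f)
    (faulty : Finset (Alea.Proc f)) (hfaulty : faulty.card ≤ f)
    {Ω : Type*} [MeasurableSpace Ω] (μ : Measure Ω) [IsProbabilityMeasure μ]
    (ρ : Ω → ℕ → Alea.Event f Msg V)
    (hexec : ∀ᵐ ω ∂μ, Alea.IsExecution F B {i | i ∉ faulty} (ρ ω))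
    (hterm : Alea.ABATermination F B {i | i ∉ faulty} μ ρ) :
    ∀ᵐ ω ∂μ, ∀ m : Msg,
      (∃ i ∉ faulty, Alea.Delivers F B (ρ ω) i m) →
        ∀ j ∉ faulty, Alea.Delivers F B (ρ ω) j m := by
  filter_upwards [hexec, Alea.ae_abaTerminates hterm] with ω hx ht m hm j hj
  obtain ⟨i, hi, hdel⟩ := hm
  exact Alea.delivers_of_delivers hx ht hi hj hdel
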